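/- Setting. Let $k\ge 1$ be the number of classes, let $P_1,\dots,P_k$ be probability laws on an input space $X$ (the class-conditional laws, the same for training and test), and let $n_1,\dots,n_k\ge 1$, $n=\sum_j n_j$. The training sample consists, for each class $j$, of a set $S_j$ of $n_j$ inputs drawn from $P_j$, all inputs being independent. On the balanced test set the label $y$ is uniform on $\{1,\dots,k\}$ and $x\sim P_y$. Let $\mathcal H$ be a family of measurable models $\eta:X\to\mathbb R^k$ containing a countable subfamily $\mathcal H_0$ such that every member of $\mathcal H$ is the pointwise limit of a sequence in $\mathcal H_0$. The softmax negative log-likelihood of $\eta$ is $$l_y(\eta)(x)=-\log\frac{e^{\eta_y(x)}}{\sum_i e^{\eta_i(x)}}=\log\Big(1+\sum_{i\ne y}e^{\eta_i(x)-\eta_y(x)}\Big).$$ Fix a threshold $t\ge 0$ and put $$err_{bal}(t)=\Pr[l_y(\eta)(x)>t]\ \text{ for a balanced test example }(x,y),\qquad \gamma_j=t-\max_{x\in S_j}l_j(\eta)(x).$$ Let $R_j$ be the Rademacher complexity of $\mathcal F_j=\{t-l_j(\eta):\eta\in\mathcal H\}$ at $n_j$ points, $R_j=\mathbb E_{x_1,\dots,x_{n_j}\sim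 P_j}\,\mathbb E_\sigma\sup_{f\in\mathcal F_j}\frac1{n_j}\sum_{i}\sigma_i f(x_i)$ with independent uniform signs $\sigma_i$, and let $C=\max_j n_jR_j^2$, that is, the least $C$ with $R_j\le\sqrt{C/n_j}$ for all $j$; assume $C<\infty$. Theorem. (1) For every $\delta>0$ there is a constant $K>0$ depending only on $\delta$ such that, in every such setting, with probability at least $1-\delta$ over the training sample, the following holds simultaneously for all $\eta\in\mathcal H$ whose margins $\gamma_1,\dots,\gamma_k$ are all positive: $$err_{bal}(t)\le K\cdot\frac1k\sum_{j=1}^k\Big(\frac1{\gamma_j}\sqrt{\frac{C}{n_j}}+\frac{\log n}{\sqrt{n_j}}\Big).$$ (2) Let $C\ge 0$, $\beta>0$, and let $n_1,\dots,n_k\ge1$ with $n=\sum_j n_j$. Among all $\gamma_1,\dots,\gamma_k>0$ with $\sum_j\gamma_j=\beta$, the quantity $\frac1k\sum_{j}\big(\frac1{\gamma_j}\sqrt{C/n_j}+\frac{\log n}{\sqrt{n_j}}\big)$ is minimal at $$\gamma_j^*=\frac{\beta\,n_j^{-1/4}}{\sum_{i=1}^k n_i^{-1/4}},$$ which is itself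 admissible, and if $C>0$ it is the only minimizer. -/

import Mathlib

open MeasureTheory
open scoped ENNReal

noncomputable section

/-- The softmax negative log-likelihood `-log (exp η_y / ∑ i, exp η_i)` of the label `y` under the
model outputs (logits) `η`, written as `log (1 + ∑_{i ≠ y} exp (η_i - η_y))`. -/
def softmaxNLL {k : ℕ} (η : Fin k → ℝ) (y : Fin k) : ℝ :=
  Real.log (1 + ∑ i ∈ Finset.univ.erase y, Real.exp (η i - η y))

/-- The law of a balanced test example `(x, y)`: the label `y` is uniform on the `k` classes and,
given `y = j`, the input `x` has the class-conditional law `P j`. -/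
def balancedLaw {k : ℕ} {X : Type*} [MeasurableSpace X] (P : Fin k → Measure X) :
    Measure (X × Fin k) :=
  (k : ℝ≥0∞)⁻¹ • ∑ j : Fin k, (P j).map (fun x => (x, j))

/-- `err_bal(t)`: the probability that the loss of the model `h` on a balanced test example
exceeds the threshold `t`. -/
def balancedError {k : ℕ} {X : Type*} [MeasurableSpace X] (P : Fin k → Measure X)
    (h : X → Fin k → ℝ) (t : ℝ) : ℝ :=
  (balancedLaw P).real {z | t < softmaxNLL (h z.1) z.2}

/-- The law of the training sample: for each class `j`, `n j` inputs drawn from `P j`, all of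
them independent. A sample is `S`, with `S j i` the `i`-th input of class `j`. -/
def trainingLaw {k : ℕ} {X : Type*} [MeasurableSpace X] (P : Fin k → Measure X) (n : Fin k → ℕ) :
    Measure ((j : Fin k) → Fin (n j) → X) :=
  Measure.pi fun j => Measure.pi fun _ => P j

/-- The margin of class `j`: the threshold minus the largest loss on the class-`j` samples
(used for `n j ≥ 1` only). -/
def classMargin {k : ℕ} {X : Type*} {n : Fin k → ℕ} (h : X → Fin k → ℝ) (t : ℝ)
    (S : (j : Fin k) → Fin (n j) → X) (j : Fin k) : ℝ :=
  t - ⨆ i : Fin (n j), softmaxNLL (h (S j i)) j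

/-- The family of functions `x ↦ t - l_j(x)` on class `j`, for the models in `H`. -/
def shiftedLossClass {k : ℕ} {X : Type*} (H : Set (X → Fin k → ℝ)) (t : ℝ) (j : Fin k) :
    Set (X → ℝ) :=
  (fun h x => t - softmaxNLL (h x) j) '' H

/-- The empirical Rademacher complexity `E_σ sup_{f ∈ F} (1/m) ∑ i, σ_i f(x_i)`, with values in
`[0, ∞]` (the supremum is taken in the extended reals; the average over the signs is nonnegative
when `F` is nonempty). -/
def empiricalRademacher {X : Type*} {m : ℕ} (F : Set (X → ℝ)) (x : Fin m → X) : ℝ≥0∞ :=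
  (2 ^ m : ℝ≥0∞)⁻¹ * (∑ σ : Fin m → ℤˣ,
    ⨆ f ∈ F, (((m : ℝ)⁻¹ * ∑ i, ((σ i : ℤ) : ℝ) * f (x i) : ℝ) : EReal)).toENNReal

/-- The Rademacher complexity for `m` independent points with law `Q`: the expectation of the
empirical one. -/
def rademacherComplexity {X : Type*} [MeasurableSpace X] (Q : Measure X) (m : ℕ)
    (F : Set (X → ℝ)) : ℝ≥0∞ :=
  ∫⁻ x : Fin m → X, empiricalRademacher F x ∂(Measure.pi fun _ => Q)

/-- The complexity measure `C`: the least number for which the Rademacher complexity of the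
class-`j` family at `n j` points is at most `√(C / n_j)`, for every class `j`. -/
def complexityMeasure {k : ℕ} {X : Type*} [MeasurableSpace X] (P : Fin k → Measure X)
    (n : Fin k → ℕ) (H : Set (X → Fin k → ℝ)) (t : ℝ) : ℝ≥0∞ :=
  ⨆ j : Fin k, (n j : ℝ≥0∞) * rademacherComplexity (P j) (n j) (shiftedLossClass H t j) ^ 2

/-- `(1/k) ∑_j ((1/γ_j) √(C/n_j) + log n / √n_j)`, where `n = ∑_j n_j`. -/
def marginBound {k : ℕ} (n : Fin k → ℕ) (C : ℝ) (γ : Fin k → ℝ) : ℝ :=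
  1 / (k : ℝ) * ∑ j, (1 / γ j * √(C / n j) + Real.log ((∑ i, n i : ℕ) : ℝ) / √(n j))

/-- The margins `γ*_j = β n_j^{-1/4} / ∑_i n_i^{-1/4}`. -/
def optimalMargin {k : ℕ} (n : Fin k → ℕ) (β : ℝ) (j : Fin k) : ℝ :=
  β * (n j : ℝ) ^ (-(1 / 4) : ℝ) / ∑ i, (n i : ℝ) ^ (-(1 / 4) : ℝ)

/-- Positive margins with sum `β`. -/
def admissibleMargins (k : ℕ) (β : ℝ) : Set (Fin k → ℝ) :=
  {γ | (∀ j, 0 < γ j) ∧ ∑ j, γ j = β}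

end

/-!
The error bound is a margin bound for each class, made uniform in the margins. For a class with
law `Q`, `m` sample points and complexity `ρ`, fix a margin level `γ` and replace the indicator of
`f < 0` by the ramp, which equals `1` on the negative reals, vanishes from `γ` on and is
`1/γ`-Lipschitz. The largest excess, over the class, of the expected ramp loss over its sample
average is concentrated around its mean (`measureReal_ge_le_of_boundedDifferences`), and the mean is
at most `2 ρ / γ` by symmetrization (`integral_iSup_deviation_le`) and contraction
(`sum_iSup_signs_le_of_contraction`). All of this takes place for finite subfamilies of the
countable dense subfamily; continuity from below of the measure and pointwise limits then give the
whole class, whose bad event is only bounded in outer measure (`measure_exists_margin_le`).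

The losses are not bounded, so neither are the margins, but finitely many levels suffice. With
`r = √(C / n j)`, margins below `r` make the bound trivial, because the error is at most `1`, and
margins beyond `r * n j` can be lowered to `r * n j`, because `r / (r * n j)` is already absorbed by
`log n / √(n j)`. The levels `i * r`, `1 ≤ i ≤ n j`, over all classes are `n = ∑ j, n j` in number
(`error_le_of_margin_grid`, `trainingLaw_error_gt_le`), and a deviation of order `log n / √(n j)`
has probability at most `δ / n` (`exp_neg_deviation_le`). This needs `log n > 0`; it fails only for
a single class, where the softmax loss is identically zero. If `C = 0`, the bound is the limit of
the bounds for `C' > 0`.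

The second part is a completed square: `1/γ` exceeds its tangent at `γ*` by `(γ - γ*)² / (γ γ*²)`,
and the tangents add up to a constant on the margins of sum `β` since `√(C / n j)` is proportional
to `(γ* j)²` (`marginBound_sub_optimal`).
-/

/-! ### The bounded differences inequality -/

/-- Exponential moment form of McDiarmid's inequality, by induction on the number of points: given
the first point, the induction hypothesis controls the others, and Hoeffding's lemma controls the
conditional expectation as a function of the first point. -/
theorem integral_exp_le_of_boundedDifferences {X : Type*} [MeasurableSpace X] (Q : Measure X)
    [IsProbabilityMeasure Q] (c : ℝ) (hc : 0 ≤ c) (r : ℝ) (m : ℕ) (g : (Fin m → X) → ℝ)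
    (hg : Measurable g) (B : ℝ) (hB : ∀ x, |g x| ≤ B)
    (hd : ∀ x y l, (∀ l', l' ≠ l → x l' = y l') → |g x - g y| ≤ c) :
    ∫ x, Real.exp (r * (g x - ∫ z, g z ∂(Measure.pi fun _ => Q))) ∂(Measure.pi fun _ => Q)
      ≤ Real.exp (m * (c / 2) ^ 2 * r ^ 2 / 2) := by
  induction m with
  | zero =>
    have h : ∀ x, g x = g default := fun x => congrArg g (Subsingleton.elim _ _)
    simp [h]
  | succ m ih =>
    have hX : Nonempty X := nonempty_of_isProbabilityMeasure Q
    set M : Measure (Fin m → X) := Measure.pi fun _ => Q with hM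
    have hmp := measurePreserving_piFinSuccAbove (α := fun _ : Fin (m + 1) => X) (fun _ => Q) 0
    have hcons : Measurable fun p : X × (Fin m → X) => (Fin.cons p.1 p.2 : Fin (m + 1) → X) := by
      refine measurable_pi_iff.mpr fun i => ?_
      refine Fin.cases ?_ (fun i => ?_) i
      · simpa using measurable_fst
      · simpa using measurable_pi_iff.mp measurable_snd i
    have hsplit : ∀ f : (Fin (m + 1) → X) → ℝ, Measurable f → (∃ D, ∀ x, |f x| ≤ D) →
        ∫ x, f x ∂(Measure.pi fun _ => Q) = ∫ y, ∫ z, f (Fin.cons y z) ∂M ∂Q := by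
      rintro f hf ⟨D, hD⟩
      have h1 : ∫ x, f x ∂(Measure.pi fun _ => Q)
          = ∫ p, f (Fin.cons p.1 p.2) ∂(Q.prod M) := by
        rw [← hmp.integral_comp (MeasurableEquiv.measurableEmbedding _)]
        refine integral_congr_ae (.of_forall fun x => ?_)
        simp [MeasurableEquiv.piFinSuccAbove, Fin.insertNthEquiv, Fin.cons_self_tail]
      rw [h1, integral_prod]
      exact Integrable.of_bound (hf.comp hcons).aestronglyMeasurable D (.of_forall fun p => hD _)
    have hgc : ∀ y, Measurable fun z : Fin m → X => g (Fin.cons y z) := fun y =>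
      hg.comp (hcons.comp measurable_prodMk_left)
    have hgi : ∀ y, Integrable (fun z : Fin m → X => g (Fin.cons y z)) M := fun y =>
      Integrable.of_bound (hgc y).aestronglyMeasurable B (.of_forall fun p => hB _)
    set G : X → ℝ := fun y => ∫ z, g (Fin.cons y z) ∂M with hGdef
    have hGm : Measurable G :=
      (StronglyMeasurable.integral_prod_right (ν := M) (f := fun y z => g (Fin.cons y z))
        (hg.comp hcons).stronglyMeasurable).measurable
    have hGB : ∀ y, |G y| ≤ B := fun y => by
      have := norm_integral_le_of_norm_le_const (μ := M) (f := fun z => g (Fin.cons y z))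
        (.of_forall fun z => hB _)
      simpa using this
    have hGd : ∀ y y', G y - G y' ≤ c := fun y y' => by
      rw [hGdef]
      simp only
      rw [← integral_sub (hgi y) (hgi y')]
      calc _ ≤ ∫ _z, c ∂M := by
            refine integral_mono ((hgi y).sub (hgi y')) (integrable_const _) fun z => ?_
            refine (le_abs_self _).trans (hd _ _ 0 fun l' hl => ?_)
            obtain ⟨i, rfl⟩ := Fin.exists_succ_eq.mpr hl
            simp
        _ = c := by simp
    have hGbdd : BddBelow (Set.range G) :=
      ⟨-B, by rintro _ ⟨y, rfl⟩; exact (abs_le.mp (hGB y)).1⟩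
    have hGI : ∀ y, G y ∈ Set.Icc (⨅ y, G y) ((⨅ y, G y) + c) := fun y => by
      refine ⟨ciInf_le hGbdd y, ?_⟩
      have : G y - c ≤ ⨅ y, G y := le_ciInf fun y' => by linarith [hGd y y']
      linarith
    have hHoef := (ProbabilityTheory.hasSubgaussianMGF_of_mem_Icc (μ := Q) hGm.aemeasurable
      (.of_forall hGI)).mgf_le r
    have hEG : ∫ z, g z ∂(Measure.pi fun _ => Q) = ∫ y, G y ∂Q := hsplit g hg ⟨B, hB⟩
    set E := ∫ y, G y ∂Q with hE
    have hHoef' : ∫ y, Real.exp (r * (G y - E)) ∂Q ≤ Real.exp ((c / 2) ^ 2 * r ^ 2 / 2) := by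
      have h3 : ((‖(⨅ y, G y) + c - ⨅ y, G y‖₊ / 2) ^ 2 : NNReal) = (c / 2) ^ 2 := by
        simp [abs_of_nonneg hc]
      rw [h3] at hHoef
      exact hHoef
    have hEB : |E| ≤ B := by
      have := norm_integral_le_of_norm_le_const (μ := Q) (f := G) (.of_forall hGB)
      simpa using this
    have hexpB : ∀ a b : ℝ, |a| ≤ B → |b| ≤ B →
        |Real.exp (r * (a - b))| ≤ Real.exp (|r| * (2 * B)) := fun a b ha hb => by
      rw [abs_of_pos (Real.exp_pos _), Real.exp_le_exp]
      refine (le_abs_self _).trans ?_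
      rw [abs_mul]
      refine mul_le_mul_of_nonneg_left ?_ (abs_nonneg _)
      linarith [abs_sub a b]
    have hGexp : Integrable (fun y => Real.exp (r * (G y - E))) Q :=
      Integrable.of_bound (by fun_prop) _ (.of_forall fun y => hexpB _ _ (hGB y) hEB)
    rw [hEG, hsplit (fun x => Real.exp (r * (g x - E))) (by fun_prop)
      ⟨_, fun x => hexpB _ _ (hB x) hEB⟩]
    have hin : ∀ y, ∫ z, Real.exp (r * (g (Fin.cons y z) - E)) ∂M
        ≤ Real.exp (m * (c / 2) ^ 2 * r ^ 2 / 2) * Real.exp (r * (G y - E)) := fun y => by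
      have h1 := ih (fun z => g (Fin.cons y z)) (hgc y) (fun z => hB _) (fun x x' l hl =>
        hd _ _ l.succ fun l' hl' => by
          revert hl'
          refine Fin.cases (fun _ => by simp) (fun i hi => ?_) l'
          simpa using hl i (fun h => hi (by rw [h])))
      refine le_trans (le_of_eq ?_) (mul_le_mul_of_nonneg_right h1 (Real.exp_pos _).le)
      rw [← integral_mul_const]
      refine integral_congr_ae (.of_forall fun z => ?_)
      simp only
      rw [← Real.exp_add]
      congr 1
      simp only [hGdef]
      ring
    calc _ ≤ ∫ y, Real.exp (m * (c / 2) ^ 2 * r ^ 2 / 2) * Real.exp (r * (G y - E)) ∂Q :=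
          integral_mono_of_nonneg
            (.of_forall fun y => integral_nonneg fun z => (Real.exp_pos _).le)
            (hGexp.const_mul _) (.of_forall hin)
      _ ≤ Real.exp (m * (c / 2) ^ 2 * r ^ 2 / 2) * Real.exp ((c / 2) ^ 2 * r ^ 2 / 2) := by
          rw [integral_const_mul]
          exact mul_le_mul_of_nonneg_left hHoef' (Real.exp_pos _).le
      _ = _ := by
          rw [← Real.exp_add]
          congr 1
          push_cast
          ring

/-- **McDiarmid's inequality** for `m` independent points with law `Q` and a function that changes
by at most `1 / m` when one point is changed. -/
theorem measureReal_ge_le_of_boundedDifferences {X : Type*} [MeasurableSpace X] (Q : Measure X)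
    [IsProbabilityMeasure Q] {m : ℕ} (hm : 0 < m) (g : (Fin m → X) → ℝ)
    (hg : Measurable g) (B : ℝ) (hB : ∀ x, |g x| ≤ B)
    (hd : ∀ x y l, (∀ l', l' ≠ l → x l' = y l') → |g x - g y| ≤ (m : ℝ)⁻¹) (s : ℝ) (hs : 0 ≤ s) :
    (Measure.pi fun _ => Q).real {x | s ≤ g x - ∫ z, g z ∂(Measure.pi fun _ => Q)}
      ≤ Real.exp (-2 * m * s ^ 2) := by
  have hm' : (0 : ℝ) < m := by exact_mod_cast hm
  set E := ∫ z, g z ∂(Measure.pi fun _ : Fin m => Q)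
  have hsub : ProbabilityTheory.HasSubgaussianMGF (fun x => g x - E) (4 * (m : NNReal))⁻¹
      (Measure.pi fun _ => Q) := by
    refine ⟨fun r => ?_, fun r => ?_⟩
    · refine Integrable.of_bound (by fun_prop) (Real.exp (|r| * (B + |E|))) (.of_forall fun x => ?_)
      rw [Real.norm_eq_abs, abs_of_pos (Real.exp_pos _), Real.exp_le_exp]
      refine (le_abs_self _).trans ?_
      rw [abs_mul]
      refine mul_le_mul_of_nonneg_left ?_ (abs_nonneg _)
      linarith [abs_sub (g x) E, hB x]
    · refine (integral_exp_le_of_boundedDifferences Q (m : ℝ)⁻¹ (by positivity) r m g hg B hB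
        hd).trans (le_of_eq ?_)
      congr 1
      push_cast
      field_simp
      ring
  refine (hsub.measure_ge_le hs).trans (le_of_eq ?_)
  congr 1
  push_cast
  field_simp
  ring

/-! ### Suprema of finite families and averages -/

theorem le_iSup_of_finite {ι : Type*} [Finite ι] (a : ι → ℝ) (i : ι) : a i ≤ ⨆ i, a i :=
  le_ciSup (Set.finite_range a).bddAbove i

theorem abs_iSup_sub_iSup_le {ι : Type*} [Finite ι] [Nonempty ι] {a b : ι → ℝ} {c : ℝ}
    (h : ∀ i, |a i - b i| ≤ c) : |(⨆ i, a i) - ⨆ i, b i| ≤ c := by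
  have h1 : (⨆ i, a i) ≤ (⨆ i, b i) + c :=
    ciSup_le fun i => by linarith [(abs_le.mp (h i)).2, le_iSup_of_finite b i]
  have h2 : (⨆ i, b i) ≤ (⨆ i, a i) + c :=
    ciSup_le fun i => by linarith [(abs_le.mp (h i)).1, le_iSup_of_finite a i]
  exact abs_le.mpr ⟨by linarith, by linarith⟩

theorem abs_iSup_le {ι : Type*} [Finite ι] [Nonempty ι] {a : ι → ℝ} {c : ℝ}
    (h : ∀ i, |a i| ≤ c) : |⨆ i, a i| ≤ c := by
  simpa using abs_iSup_sub_iSup_le (a := a) (b := fun _ => 0) (by simpa using h)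

theorem abs_average_le {m : ℕ} {a : Fin m → ℝ} {c : ℝ} (hc : 0 ≤ c) (h : ∀ l, |a l| ≤ c) :
    |(m : ℝ)⁻¹ * ∑ l, a l| ≤ c := by
  rcases Nat.eq_zero_or_pos m with rfl | hm
  · simpa using hc
  have hm' : (0 : ℝ) < m := by exact_mod_cast hm
  rw [abs_mul, abs_of_nonneg (by positivity : (0 : ℝ) ≤ (m : ℝ)⁻¹), inv_mul_le_iff₀ hm']
  refine (Finset.abs_sum_le_sum_abs _ _).trans ((Finset.sum_le_sum fun l _ => h l).trans ?_)
  simp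

theorem abs_sign_mul (σ : ℤˣ) (a : ℝ) : |((σ : ℤ) : ℝ) * a| = |a| := by
  rcases Int.units_eq_one_or σ with rfl | rfl <;> simp

/-! ### Contraction -/

/-- Comparison of two signs: the case of a single coordinate in the contraction inequality. -/
theorem iSup_add_iSup_sub_le {ι : Type*} [Finite ι] [Nonempty ι] (b u v : ι → ℝ)
    (h : ∀ i j, u i - u j ≤ |v i - v j|) :
    (⨆ i, (b i + u i)) + (⨆ i, (b i - u i)) ≤ (⨆ i, (b i + v i)) + ⨆ i, (b i - v i) := by
  obtain ⟨i, hi⟩ := exists_eq_ciSup_of_finite (f := fun i => b i + u i)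
  obtain ⟨j, hj⟩ := exists_eq_ciSup_of_finite (f := fun i => b i - u i)
  rw [← hi, ← hj]
  have h1 := h i j
  rcases abs_cases (v i - v j) with h2 | h2
  · linarith [le_iSup_of_finite (fun i => b i + v i) i, le_iSup_of_finite (fun i => b i - v i) j]
  · linarith [le_iSup_of_finite (fun i => b i + v i) j, le_iSup_of_finite (fun i => b i - v i) i]

theorem sum_signs_succ {m : ℕ} (f : (Fin (m + 1) → ℤˣ) → ℝ) :
    ∑ σ, f σ = ∑ σ : Fin m → ℤˣ, (f (Fin.cons 1 σ) + f (Fin.cons (-1) σ)) := by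
  rw [← (Fin.consEquiv fun _ : Fin (m + 1) => ℤˣ).sum_comp, Fintype.sum_prod_type, UnitsInt.univ,
    Finset.sum_pair (by decide), ← Finset.sum_add_distrib]
  rfl

/-- The **contraction inequality** for Rademacher averages of a finite family: replacing each
coordinate by a contraction of it does not increase the average supremum. The offset `b` is there
for the induction on the number of coordinates. -/
theorem sum_iSup_signs_le_of_contraction {ι : Type*} [Finite ι] [Nonempty ι] (m : ℕ)
    (b : ι → ℝ) (u v : ι → Fin m → ℝ) (h : ∀ l i j, u i l - u j l ≤ |v i l - v j l|) :
    ∑ σ : Fin m → ℤˣ, ⨆ i, (b i + ∑ l, ((σ l : ℤ) : ℝ) * u i l) ≤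
      ∑ σ : Fin m → ℤˣ, ⨆ i, (b i + ∑ l, ((σ l : ℤ) : ℝ) * v i l) := by
  induction m generalizing b with
  | zero => simp
  | succ m ih =>
    simp only [sum_signs_succ, Fin.sum_univ_succ, Fin.cons_zero, Fin.cons_succ]
    simp only [Units.val_one, Units.val_neg, Int.cast_one, Int.cast_neg, one_mul, neg_mul,
      ← add_assoc]
    rw [Finset.sum_add_distrib]
    refine (add_le_add (ih (fun i => b i + u i 0) _ (fun i l => v i l.succ) fun l => h l.succ)
      (ih (fun i => b i + -u i 0) _ (fun i l => v i l.succ) fun l => h l.succ)).trans ?_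
    rw [← Finset.sum_add_distrib]
    refine Finset.sum_le_sum fun σ _ => ?_
    have := iSup_add_iSup_sub_le (fun i => b i + ∑ l, ((σ l : ℤ) : ℝ) * v i l.succ)
      (fun i => u i 0) (fun i => v i 0) (h 0)
    refine le_of_eq_of_le ?_ (this.trans_eq ?_) <;> congr 1 <;>
      exact iSup_congr fun i => by ring

/-! ### Symmetrization -/

/-- **Symmetrization** for a finite family of functions with values in `[-1, 1]`: the expected
largest excess of an expectation over the empirical average is at most twice the expected
Rademacher average. The first inequality is Jensen's, with an independent copy of the sample; the
law of the pair of samples is invariant under exchanging the two copies of any of the points. -/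
theorem integral_iSup_deviation_le {X ι : Type*} [MeasurableSpace X] (Q : Measure X)
    [IsProbabilityMeasure Q] [Finite ι] [Nonempty ι] {m : ℕ} (hm : 0 < m) (g : ι → X → ℝ)
    (hg : ∀ i, Measurable (g i)) (hB : ∀ i x, |g i x| ≤ 1) :
    ∫ x, ⨆ i, ((∫ y, g i y ∂Q) - (m : ℝ)⁻¹ * ∑ l : Fin m, g i (x l)) ∂(Measure.pi fun _ => Q) ≤
      2 * ∫ x, (2 ^ m : ℝ)⁻¹ * ∑ σ : Fin m → ℤˣ, ⨆ i, (m : ℝ)⁻¹ * ∑ l, ((σ l : ℤ) : ℝ) * g i (x l)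
        ∂(Measure.pi fun _ => Q) := by
  have hm' : (m : ℝ) ≠ 0 := by exact_mod_cast hm.ne'
  set M : Measure (Fin m → X) := Measure.pi fun _ => Q with hM
  set W : Measure (Fin m → X × X) := Measure.pi fun _ => Q.prod Q with hW
  have hgd : ∀ i x y, |g i x - g i y| ≤ 2 := fun i x y => by
    linarith [abs_sub (g i x) (g i y), hB i x, hB i y]
  have hfst : MeasurePreserving (fun (w : Fin m → X × X) l => (w l).1) W M :=
    measurePreserving_pi _ _ fun _ => measurePreserving_fst
  have hsnd : MeasurePreserving (fun (w : Fin m → X × X) l => (w l).2) W M :=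
    measurePreserving_pi _ _ fun _ => measurePreserving_snd
  -- `T σ` is the symmetrized excess with the copies exchanged where `σ` is `-1`.
  set T : (Fin m → ℤˣ) → ℝ := fun σ =>
    ∫ w, ⨆ i, (m : ℝ)⁻¹ * ∑ l, ((σ l : ℤ) : ℝ) * (g i (w l).2 - g i (w l).1) ∂W with hT
  set S : (Fin m → ℤˣ) → ℝ := fun σ =>
    ∫ x, ⨆ i, (m : ℝ)⁻¹ * ∑ l, ((σ l : ℤ) : ℝ) * g i (x l) ∂M with hS
  have hSI : ∀ σ : Fin m → ℤˣ,
      Integrable (fun x => ⨆ i, (m : ℝ)⁻¹ * ∑ l, ((σ l : ℤ) : ℝ) * g i (x l)) M := fun σ =>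
    Integrable.of_bound (Measurable.iSup fun i => by fun_prop).aestronglyMeasurable 1
      (.of_forall fun x => abs_iSup_le fun i => abs_average_le zero_le_one fun l => by
        rw [abs_sign_mul]; exact hB _ _)
  have hTI : ∀ σ : Fin m → ℤˣ, Integrable (fun w : Fin m → X × X => ⨆ i, (m : ℝ)⁻¹ *
      ∑ l, ((σ l : ℤ) : ℝ) * (g i (w l).2 - g i (w l).1)) W := fun σ =>
    Integrable.of_bound (Measurable.iSup fun i => by fun_prop).aestronglyMeasurable 2
      (.of_forall fun x => abs_iSup_le fun i => abs_average_le zero_le_two fun l => by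
        rw [abs_sign_mul]; exact hgd _ _ _)
  have hPhiM : Measurable fun p : (Fin m → X) × (Fin m → X) =>
      ⨆ i, (m : ℝ)⁻¹ * ∑ l, (g i (p.2 l) - g i (p.1 l)) :=
    Measurable.iSup fun i => by fun_prop
  have hPhiB : ∀ p : (Fin m → X) × (Fin m → X),
      |⨆ i, (m : ℝ)⁻¹ * ∑ l, (g i (p.2 l) - g i (p.1 l))| ≤ 2 := fun p =>
    abs_iSup_le fun i => abs_average_le zero_le_two fun l => hgd _ _ _
  have hPhiI : Integrable (fun p : (Fin m → X) × (Fin m → X) =>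
      ⨆ i, (m : ℝ)⁻¹ * ∑ l, (g i (p.2 l) - g i (p.1 l))) (M.prod M) :=
    Integrable.of_bound hPhiM.aestronglyMeasurable 2 (.of_forall hPhiB)
  have hmean : ∀ i, ∫ z, (m : ℝ)⁻¹ * ∑ l, g i (z l) ∂M = ∫ y, g i y ∂Q := fun i => by
    have hl : ∀ l : Fin m, Integrable (fun z => g i (z l)) M := fun l =>
      Integrable.of_bound ((hg i).comp (measurable_pi_apply l)).aestronglyMeasurable 1
        (.of_forall fun z => hB i (z l))
    rw [integral_const_mul, integral_finsetSum _ fun l _ => hl l]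
    have : ∀ l, ∫ z, g i (z l) ∂M = ∫ y, g i y ∂Q := fun l =>
      integral_comp_eval (μ := fun _ : Fin m => Q) (i := l) (hg i).aestronglyMeasurable
    simp [this, hm']
  have hstep1 : ∀ x : Fin m → X, (⨆ i, ((∫ y, g i y ∂Q) - (m : ℝ)⁻¹ * ∑ l, g i (x l))) ≤
      ∫ z, ⨆ i, (m : ℝ)⁻¹ * ∑ l, (g i (z l) - g i (x l)) ∂M := fun x => by
    refine ciSup_le fun i => ?_
    have hi : Integrable (fun z : Fin m → X => (m : ℝ)⁻¹ * ∑ l, g i (z l)) M :=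
      Integrable.of_bound (Measurable.aestronglyMeasurable (by fun_prop)) 1 (.of_forall fun z =>
        abs_average_le zero_le_one fun l => hB _ _)
    calc _ = ∫ z, ((m : ℝ)⁻¹ * ∑ l, g i (z l) - (m : ℝ)⁻¹ * ∑ l, g i (x l)) ∂M := by
          rw [integral_sub hi (integrable_const _), hmean]; simp
      _ ≤ _ := by
          refine integral_mono (hi.sub (integrable_const _)) (Integrable.of_bound
            (hPhiM.comp measurable_prodMk_left).aestronglyMeasurable 2
              (.of_forall fun z => hPhiB (x, z))) fun z => ?_
          refine le_of_eq_of_le ?_ (le_iSup_of_finite _ i)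
          rw [Finset.sum_sub_distrib, mul_sub]
  have hstep2 : ∫ x, ∫ z, ⨆ i, (m : ℝ)⁻¹ * ∑ l, (g i (z l) - g i (x l)) ∂M ∂M = T 1 := by
    rw [← integral_prod _ hPhiI,
      ← (measurePreserving_arrowProdEquivProdArrow X X (Fin m) (fun _ => Q)
        (fun _ => Q)).integral_comp (MeasurableEquiv.measurableEmbedding _)]
    simp only [hT, Pi.one_apply, Units.val_one, Int.cast_one, one_mul]
    rfl
  have hstep3 : ∀ σ, T σ = T 1 := fun σ => by
    have hsw : MeasurePreserving
        (fun (w : Fin m → X × X) l => (if σ l = 1 then id else Prod.swap) (w l)) W W :=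
      measurePreserving_pi _ _ fun l => by
        split_ifs
        · exact MeasurePreserving.id _
        · exact Measure.measurePreserving_swap
    have := integral_map hsw.measurable.aemeasurable
      (by rw [hsw.map_eq]; exact (hTI 1).aestronglyMeasurable)
    rw [hsw.map_eq] at this
    simp only [hT]
    rw [this]
    refine integral_congr_ae (.of_forall fun w => ?_)
    refine iSup_congr fun i => ?_
    congr 1
    refine Finset.sum_congr rfl fun l _ => ?_
    rcases Int.units_eq_one_or (σ l) with h | h
    · simp [h]
    · have : (-1 : ℤˣ) ≠ 1 := by decide
      simp [h, this]
  have hstep4 : ∀ σ, T σ ≤ S σ + S (-σ) := fun σ => by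
    have h1 : S σ = ∫ w, ⨆ i, (m : ℝ)⁻¹ * ∑ l, ((σ l : ℤ) : ℝ) * g i (w l).2 ∂W := by
      simp only [hS]
      rw [← hsnd.map_eq, integral_map hsnd.measurable.aemeasurable]
      rw [hsnd.map_eq]; exact (hSI σ).aestronglyMeasurable
    have h2 : S (-σ) = ∫ w, ⨆ i, (m : ℝ)⁻¹ * ∑ l, (((-σ) l : ℤ) : ℝ) * g i (w l).1 ∂W := by
      simp only [hS]
      rw [← hfst.map_eq, integral_map hfst.measurable.aemeasurable]
      rw [hfst.map_eq]; exact (hSI (-σ)).aestronglyMeasurable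
    have h3 : Integrable (fun w : Fin m → X × X =>
        ⨆ i, (m : ℝ)⁻¹ * ∑ l, ((σ l : ℤ) : ℝ) * g i (w l).2) W :=
      hsnd.integrable_comp_of_integrable (hSI σ)
    have h4 : Integrable (fun w : Fin m → X × X =>
        ⨆ i, (m : ℝ)⁻¹ * ∑ l, (((-σ) l : ℤ) : ℝ) * g i (w l).1) W :=
      hfst.integrable_comp_of_integrable (hSI (-σ))
    rw [h1, h2, ← integral_add h3 h4]
    refine integral_mono (hTI σ) (h3.add h4) fun w => ciSup_le fun i => ?_
    refine le_of_eq_of_le ?_ (add_le_add (le_iSup_of_finite _ i) (le_iSup_of_finite _ i))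
    rw [← mul_add, ← Finset.sum_add_distrib]
    congr 1
    refine Finset.sum_congr rfl fun l _ => ?_
    simp
    ring
  have hcard : ∑ _σ : Fin m → ℤˣ, T 1 = 2 ^ m * T 1 := by
    simp [Fintype.card_pi]
  have hsum : 2 ^ m * T 1 ≤ 2 * ∑ σ, S σ := by
    rw [← hcard]
    calc ∑ _σ : Fin m → ℤˣ, T 1 ≤ ∑ σ, (S σ + S (-σ)) :=
          Finset.sum_le_sum fun σ _ => hstep3 σ ▸ hstep4 σ
      _ = 2 * ∑ σ, S σ := by
          rw [Finset.sum_add_distrib, show ∑ σ, S (-σ) = ∑ σ, S σ from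
            Equiv.sum_comp (Equiv.neg (Fin m → ℤˣ)) S]
          ring
  have hint : Integrable (fun x => ⨆ i, ((∫ y, g i y ∂Q) - (m : ℝ)⁻¹ * ∑ l, g i (x l))) M :=
    Integrable.of_bound (Measurable.iSup fun i => by fun_prop).aestronglyMeasurable 2
      (.of_forall fun x => abs_iSup_le fun i => by
        have h1 : |∫ y, g i y ∂Q| ≤ 1 := by
          simpa using norm_integral_le_of_norm_le_const (μ := Q) (f := g i) (.of_forall (hB i))
        have h2 : |(m : ℝ)⁻¹ * ∑ l, g i (x l)| ≤ 1 := abs_average_le zero_le_one fun l => hB _ _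
        linarith [abs_sub (∫ y, g i y ∂Q) ((m : ℝ)⁻¹ * ∑ l, g i (x l))])
  calc _ ≤ T 1 := hstep2 ▸ integral_mono hint hPhiI.integral_prod_left hstep1
    _ ≤ 2 * ((2 ^ m : ℝ)⁻¹ * ∑ σ, S σ) := by
        rw [mul_left_comm, ← div_eq_inv_mul, le_div_iff₀ (by positivity)]
        linarith
    _ = _ := by rw [integral_const_mul, integral_finsetSum _ fun σ _ => hSI σ]

/-! ### The ramp loss -/

/-- The ramp at scale `γ`: `1` on `(-∞, 0]`, `0` on `[γ, ∞)`, and affine in between. -/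
noncomputable def ramp (γ y : ℝ) : ℝ := max 0 (min 1 (1 - y / γ))

theorem continuous_ramp (γ : ℝ) : Continuous (ramp γ) := by unfold ramp; fun_prop

theorem ramp_nonneg (γ y : ℝ) : 0 ≤ ramp γ y := le_max_left _ _

theorem ramp_le_one (γ y : ℝ) : ramp γ y ≤ 1 := max_le zero_le_one (min_le_left _ _)

theorem abs_ramp_le_one (γ y : ℝ) : |ramp γ y| ≤ 1 := by
  rw [abs_of_nonneg (ramp_nonneg _ _)]; exact ramp_le_one _ _

theorem ramp_of_le {γ y : ℝ} (hγ : 0 < γ) (h : γ ≤ y) : ramp γ y = 0 := by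
  refine max_eq_left ((min_le_right _ _).trans ?_)
  linarith [(one_le_div hγ).mpr h]

theorem ramp_of_nonpos {γ y : ℝ} (hγ : 0 < γ) (h : y ≤ 0) : ramp γ y = 1 := by
  have : y / γ ≤ 0 := div_nonpos_of_nonpos_of_nonneg h hγ.le
  rw [ramp, min_eq_left (by linarith), max_eq_right zero_le_one]

theorem ramp_sub_le (γ y z : ℝ) : ramp γ y - ramp γ z ≤ |y / γ - z / γ| := by
  have h := neg_abs_le (y / γ - z / γ)
  have h0 := abs_nonneg (y / γ - z / γ)
  unfold ramp
  rw [sub_le_iff_le_add]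
  refine max_le (by linarith [le_max_left 0 (min 1 (1 - z / γ))]) ?_
  rcases le_total 1 (1 - z / γ) with h1 | h1
  · rw [min_eq_left h1]
    linarith [min_le_left 1 (1 - y / γ), le_max_right (0 : ℝ) 1]
  · rw [min_eq_right h1]
    linarith [min_le_right 1 (1 - y / γ), le_max_right 0 (1 - z / γ)]

theorem measureReal_neg_le_integral_ramp {X : Type*} [MeasurableSpace X] (Q : Measure X)
    [IsProbabilityMeasure Q] {γ : ℝ} (hγ : 0 < γ) {f : X → ℝ} (hf : Measurable f) :
    Q.real {x | f x < 0} ≤ ∫ x, ramp γ (f x) ∂Q := by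
  have hs : MeasurableSet {x | f x < 0} := measurableSet_lt hf measurable_const
  rw [← integral_indicator_one hs]
  refine integral_mono ((integrable_const (1 : ℝ)).indicator hs)
    (Integrable.of_bound ((continuous_ramp γ).measurable.comp hf).aestronglyMeasurable 1
      (.of_forall fun x => abs_ramp_le_one _ _)) fun x => ?_
  by_cases hx : f x < 0
  · rw [Set.indicator_of_mem (by exact hx), ramp_of_nonpos hγ hx.le]; rfl
  · rw [Set.indicator_of_notMem (by exact hx)]; exact ramp_nonneg _ _

/-! ### Margin bound for one class of functions -/

theorem ofReal_average_iSup_le_empiricalRademacher {X ι : Type*} [Finite ι] [Nonempty ι] {m : ℕ}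
    {F : Set (X → ℝ)} (f : ι → X → ℝ) (hf : ∀ i, f i ∈ F) (x : Fin m → X) :
    ENNReal.ofReal ((2 ^ m : ℝ)⁻¹ * ∑ σ : Fin m → ℤˣ,
      ⨆ i, (m : ℝ)⁻¹ * ∑ l, ((σ l : ℤ) : ℝ) * f i (x l)) ≤ empiricalRademacher F x := by
  rw [ENNReal.ofReal_mul (by positivity), ENNReal.ofReal_inv_of_pos (by positivity),
    ENNReal.ofReal_pow (by norm_num), ENNReal.ofReal_ofNat, empiricalRademacher]
  gcongr
  have hcoe : ∀ (s : Finset (Fin m → ℤˣ)) (a : (Fin m → ℤˣ) → ℝ),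
      ((∑ σ ∈ s, a σ : ℝ) : EReal) = ∑ σ ∈ s, (a σ : EReal) := fun s a => by
    induction s using Finset.cons_induction with
    | empty => simp
    | cons b s hb ih => rw [Finset.sum_cons, Finset.sum_cons, EReal.coe_add, ih]
  have htop : ∀ a : ℝ, ENNReal.ofReal a = (a : EReal).toENNReal := fun a => by
    rw [EReal.toENNReal_of_ne_top (EReal.coe_ne_top _), EReal.toReal_coe]
  rw [htop, hcoe]
  refine EReal.toENNReal_le_toENNReal (Finset.sum_le_sum fun σ _ => ?_)
  obtain ⟨j, hj⟩ := exists_eq_ciSup_of_finite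
    (f := fun i => (m : ℝ)⁻¹ * ∑ l, ((σ l : ℤ) : ℝ) * f i (x l))
  rw [← hj]
  exact le_iSup₂_of_le (f j) (hf j) le_rfl

/-- Uniform deviation of the ramp losses of a finite family: McDiarmid's inequality, with the
expectation bounded by symmetrization and contraction. -/
theorem measure_ramp_deviation_le {X ι : Type*} [MeasurableSpace X] (Q : Measure X)
    [IsProbabilityMeasure Q] [Finite ι] [Nonempty ι] {m : ℕ} (hm : 0 < m) (f : ι → X → ℝ)
    (hf : ∀ i, Measurable (f i)) {ρ γ s : ℝ} (hρ : 0 ≤ ρ) (hγ : 0 < γ) (hs : 0 ≤ s)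
    (hR : ∫⁻ x, ENNReal.ofReal ((2 ^ m : ℝ)⁻¹ * ∑ σ : Fin m → ℤˣ,
      ⨆ i, (m : ℝ)⁻¹ * ∑ l, ((σ l : ℤ) : ℝ) * f i (x l)) ∂(Measure.pi fun _ => Q)
        ≤ ENNReal.ofReal ρ) :
    (Measure.pi fun _ => Q) {x : Fin m → X | ∃ i, 2 * ρ / γ + s ≤
      (∫ y, ramp γ (f i y) ∂Q) - (m : ℝ)⁻¹ * ∑ l, ramp γ (f i (x l))}
        ≤ ENNReal.ofReal (Real.exp (-2 * m * s ^ 2)) := by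
  have hm' : (0 : ℝ) < m := by exact_mod_cast hm
  set M : Measure (Fin m → X) := Measure.pi fun _ => Q with hM
  set g : ι → X → ℝ := fun i y => ramp γ (f i y) with hgdef
  have hg : ∀ i, Measurable (g i) := fun i => (continuous_ramp γ).measurable.comp (hf i)
  have hB : ∀ i x, |g i x| ≤ 1 := fun i x => abs_ramp_le_one _ _
  set D : (Fin m → X) → ℝ := fun x => ⨆ i, ((∫ y, g i y ∂Q) - (m : ℝ)⁻¹ * ∑ l, g i (x l)) with hD
  have hDm : Measurable D := Measurable.iSup fun i => by fun_prop
  have hDB : ∀ x, |D x| ≤ 2 := fun x => abs_iSup_le fun i => by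
    have h1 : |∫ y, g i y ∂Q| ≤ 1 := by
      simpa using norm_integral_le_of_norm_le_const (μ := Q) (f := g i) (.of_forall (hB i))
    have h2 : |(m : ℝ)⁻¹ * ∑ l, g i (x l)| ≤ 1 := abs_average_le zero_le_one fun l => hB _ _
    linarith [abs_sub (∫ y, g i y ∂Q) ((m : ℝ)⁻¹ * ∑ l, g i (x l))]
  have hDd : ∀ x y l, (∀ l', l' ≠ l → x l' = y l') → |D x - D y| ≤ (m : ℝ)⁻¹ := fun x y l h => by
    refine abs_iSup_sub_iSup_le fun i => ?_
    have h1 : ∑ l, g i (y l) - ∑ l, g i (x l) = g i (y l) - g i (x l) := by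
      rw [← Finset.sum_sub_distrib]
      exact Finset.sum_eq_single l (fun l' _ hl => by rw [h l' hl, sub_self]) (by simp)
    rw [sub_sub_sub_cancel_left, ← mul_sub, h1, abs_mul, abs_of_pos (inv_pos.mpr hm')]
    refine mul_le_of_le_one_right (inv_pos.mpr hm').le (abs_le.mpr ?_)
    have h2 := ramp_nonneg γ (f i (y l))
    have h3 := ramp_nonneg γ (f i (x l))
    have h4 := ramp_le_one γ (f i (y l))
    have h5 := ramp_le_one γ (f i (x l))
    exact ⟨by simp only [hgdef]; linarith, by simp only [hgdef]; linarith⟩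
  have hcontr : ∀ x : Fin m → X,
      (2 ^ m : ℝ)⁻¹ * ∑ σ : Fin m → ℤˣ, ⨆ i, (m : ℝ)⁻¹ * ∑ l, ((σ l : ℤ) : ℝ) * g i (x l) ≤
      γ⁻¹ * ((2 ^ m : ℝ)⁻¹ * ∑ σ : Fin m → ℤˣ,
        ⨆ i, (m : ℝ)⁻¹ * ∑ l, ((σ l : ℤ) : ℝ) * f i (x l)) := fun x => by
    rw [mul_left_comm]
    refine mul_le_mul_of_nonneg_left ?_ (by positivity)
    have h1 := sum_iSup_signs_le_of_contraction m (fun _ : ι => 0) (fun i l => g i (x l))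
      (fun i l => f i (x l) / γ) fun l i j => ramp_sub_le γ _ _
    simp only [zero_add] at h1
    simp only [← Real.mul_iSup_of_nonneg (inv_pos.mpr hm').le, ← Finset.mul_sum]
    rw [mul_left_comm]
    refine mul_le_mul_of_nonneg_left (h1.trans (le_of_eq ?_)) (by positivity)
    rw [Finset.mul_sum]
    refine Finset.sum_congr rfl fun σ _ => ?_
    rw [Real.mul_iSup_of_nonneg (inv_pos.mpr hγ).le]
    refine iSup_congr fun i => ?_
    rw [Finset.mul_sum]
    exact Finset.sum_congr rfl fun l _ => by rw [div_eq_inv_mul]; ring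
  set S : (Fin m → X) → ℝ := fun x =>
    (2 ^ m : ℝ)⁻¹ * ∑ σ : Fin m → ℤˣ, ⨆ i, (m : ℝ)⁻¹ * ∑ l, ((σ l : ℤ) : ℝ) * g i (x l) with hS
  have hSI : Integrable S M := by
    refine (integrable_finsetSum _ fun σ _ => ?_).const_mul _
    exact Integrable.of_bound (Measurable.iSup fun i => by fun_prop).aestronglyMeasurable 1
      (.of_forall fun x => abs_iSup_le fun i => abs_average_le zero_le_one fun l => by
        rw [abs_sign_mul]; exact hB _ _)
  have hSle : ∫ x, S x ∂M ≤ γ⁻¹ * ρ := by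
    rw [integral_eq_lintegral_pos_part_sub_lintegral_neg_part hSI]
    refine (sub_le_self _ ENNReal.toReal_nonneg).trans
      (ENNReal.toReal_le_of_le_ofReal (by positivity) ?_)
    calc ∫⁻ x, ENNReal.ofReal (S x) ∂M ≤ ∫⁻ x, ENNReal.ofReal γ⁻¹ * ENNReal.ofReal
          ((2 ^ m : ℝ)⁻¹ * ∑ σ : Fin m → ℤˣ,
            ⨆ i, (m : ℝ)⁻¹ * ∑ l, ((σ l : ℤ) : ℝ) * f i (x l)) ∂M :=
          lintegral_mono fun x => by
            rw [← ENNReal.ofReal_mul (by positivity)]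
            exact ENNReal.ofReal_le_ofReal (hcontr x)
      _ ≤ ENNReal.ofReal (γ⁻¹ * ρ) := by
          rw [lintegral_const_mul' _ _ ENNReal.ofReal_ne_top, ENNReal.ofReal_mul (by positivity)]
          gcongr
  have hED : ∫ x, D x ∂M ≤ 2 * ρ / γ :=
    (integral_iSup_deviation_le Q hm g hg hB).trans
      ((mul_le_mul_of_nonneg_left hSle zero_le_two).trans_eq (by rw [div_eq_inv_mul]; ring))
  refine (measure_mono (t := {x | s ≤ D x - ∫ z, D z ∂M}) ?_).trans ?_
  · rintro x ⟨i, hi⟩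
    have := le_iSup_of_finite (fun i => (∫ y, g i y ∂Q) - (m : ℝ)⁻¹ * ∑ l, g i (x l)) i
    simp only [Set.mem_ofPred_eq, hD] at hED ⊢
    simp only [hgdef] at this hED ⊢
    linarith
  · rw [← ofReal_measureReal]
    exact ENNReal.ofReal_le_ofReal
      (measureReal_ge_le_of_boundedDifferences Q hm D hDm 2 hDB hDd s hs)

/-- The margin bound at a fixed margin level `γ`: outside an event of probability at most
`exp (-2 m s²)`, every function of the class that is at least `γ` on the sample is negative with
probability at most `2 ρ / γ + s`. The event need not be measurable; it is covered by an increasing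
union of deviation events for finite subfamilies of `F₀`. -/
theorem measure_exists_margin_le {X : Type*} [MeasurableSpace X] (Q : Measure X)
    [IsProbabilityMeasure Q] {m : ℕ} (hm : 0 < m) {F F₀ : Set (X → ℝ)}
    (hF : ∀ f ∈ F, Measurable f) (hsub : F₀ ⊆ F) (hc : F₀.Countable) (hcl : F ⊆ seqClosure F₀)
    {ρ γ s : ℝ} (hρ : 0 ≤ ρ) (hγ : 0 < γ) (hs : 0 ≤ s)
    (hR : rademacherComplexity Q m F ≤ ENNReal.ofReal ρ) :
    (Measure.pi fun _ => Q) {x : Fin m → X | ∃ f ∈ F, (∀ l, γ ≤ f (x l)) ∧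
      2 * ρ / γ + s < Q.real {y | f y < 0}} ≤ ENNReal.ofReal (Real.exp (-2 * m * s ^ 2)) := by
  rcases F₀.eq_empty_or_nonempty with rfl | hne
  · have : F = ∅ := Set.eq_empty_of_forall_notMem fun f hf => by
      obtain ⟨u, hu, -⟩ := hcl hf
      exact hu 0
    simp [this]
  obtain ⟨u, rfl⟩ := hc.exists_eq_range hne
  have huF : ∀ p, u p ∈ F := fun p => hsub ⟨p, rfl⟩
  set A : ℕ → Set (Fin m → X) := fun N => {x | ∃ i : Fin (N + 1), 2 * ρ / γ + s ≤
    (∫ y, ramp γ (u i y) ∂Q) - (m : ℝ)⁻¹ * ∑ l, ramp γ (u i (x l))} with hA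
  have hmono : Monotone A := fun N N' h x ⟨i, hi⟩ => ⟨⟨i, by omega⟩, hi⟩
  refine (measure_mono (t := ⋃ N, A N) ?_).trans ?_
  · rintro x ⟨f, hfF, hfx, hlt⟩
    obtain ⟨v, hv, hvf⟩ := hcl hfF
    rw [tendsto_pi_nhds] at hvf
    have hpt : ∀ y, Filter.Tendsto (fun p => ramp γ (v p y)) Filter.atTop (nhds (ramp γ (f y))) :=
      fun y => ((continuous_ramp γ).tendsto _).comp (hvf y)
    have h1 : Filter.Tendsto (fun p => ∫ y, ramp γ (v p y) ∂Q) Filter.atTop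
        (nhds (∫ y, ramp γ (f y) ∂Q)) :=
      tendsto_integral_of_dominated_convergence (fun _ => 1)
        (fun p => ((continuous_ramp γ).measurable.comp
          (hF _ (hsub (hv p)))).aestronglyMeasurable)
        (integrable_const _) (fun p => .of_forall fun y => abs_ramp_le_one _ _)
        (.of_forall hpt)
    have h2 : Filter.Tendsto (fun p => (m : ℝ)⁻¹ * ∑ l, ramp γ (v p (x l))) Filter.atTop
        (nhds ((m : ℝ)⁻¹ * ∑ l, ramp γ (f (x l)))) :=
      (tendsto_finsetSum _ fun l _ => hpt (x l)).const_mul _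
    have h3 : 2 * ρ / γ + s < (∫ y, ramp γ (f y) ∂Q) - (m : ℝ)⁻¹ * ∑ l, ramp γ (f (x l)) := by
      simp only [ramp_of_le hγ (hfx _), Finset.sum_const_zero, mul_zero, sub_zero]
      exact hlt.trans_le (measureReal_neg_le_integral_ramp Q hγ (hF f hfF))
    obtain ⟨p, hp⟩ := ((h1.sub h2).eventually (lt_mem_nhds h3)).exists
    obtain ⟨N, hN⟩ := hv p
    exact Set.mem_iUnion.mpr ⟨N, ⟨N, by omega⟩, by simp only [hN]; exact hp.le⟩
  · rw [hmono.measure_iUnion]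
    refine iSup_le fun N => measure_ramp_deviation_le Q hm (fun i : Fin (N + 1) => u i)
      (fun i => hF _ (huF _)) hρ hγ hs (le_trans ?_ hR)
    exact lintegral_mono fun x => ofReal_average_iSup_le_empiricalRademacher _ (fun i => huF _) x

/-! ### The softmax loss and the balanced error -/

theorem continuous_softmaxNLL {k : ℕ} (y : Fin k) : Continuous fun η => softmaxNLL η y := by
  unfold softmaxNLL
  refine Continuous.log (by fun_prop) fun η => ?_
  positivity

theorem measurable_shiftedLoss {k : ℕ} {X : Type*} [MeasurableSpace X] {h : X → Fin k → ℝ}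
    (hh : Measurable h) (t : ℝ) (j : Fin k) : Measurable fun x => t - softmaxNLL (h x) j :=
  measurable_const.sub ((continuous_softmaxNLL j).measurable.comp hh)

theorem shiftedLossClass_subset_seqClosure {k : ℕ} {X : Type*} {H H₀ : Set (X → Fin k → ℝ)}
    (hcl : H ⊆ seqClosure H₀) (t : ℝ) (j : Fin k) :
    shiftedLossClass H t j ⊆ seqClosure (shiftedLossClass H₀ t j) := by
  rintro _ ⟨h, hh, rfl⟩
  obtain ⟨u, hu, hlim⟩ := hcl hh
  refine ⟨fun p x => t - softmaxNLL (u p x) j, fun p => ⟨u p, hu p, rfl⟩, ?_⟩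
  rw [tendsto_pi_nhds] at hlim ⊢
  exact fun x => (((continuous_softmaxNLL j).tendsto _).comp (hlim x)).const_sub t

theorem balancedError_eq_average {k : ℕ} {X : Type*} [MeasurableSpace X] (P : Fin k → Measure X)
    [∀ j, IsProbabilityMeasure (P j)] {h : X → Fin k → ℝ} (hh : Measurable h) (t : ℝ) :
    balancedError P h t = 1 / (k : ℝ) * ∑ j, (P j).real {x | t - softmaxNLL (h x) j < 0} := by
  have hm : Measurable fun z : X × Fin k => softmaxNLL (h z.1) z.2 :=
    measurable_from_prod_countable_left fun y => (continuous_softmaxNLL y).measurable.comp hh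
  have hs : MeasurableSet {z : X × Fin k | t < softmaxNLL (h z.1) z.2} :=
    measurableSet_lt measurable_const hm
  have hj : ∀ j : Fin k, ((P j).map fun x => (x, j)) {z | t < softmaxNLL (h z.1) z.2}
      = P j {x | t - softmaxNLL (h x) j < 0} := fun j => by
    rw [Measure.map_apply measurable_prodMk_right hs]
    simp only [sub_neg]
    rfl
  rw [balancedError, balancedLaw, measureReal_def, Measure.smul_apply, Measure.finsetSum_apply,
    Finset.sum_congr rfl fun j _ => hj j, smul_eq_mul, ENNReal.toReal_mul,
    ENNReal.toReal_sum fun j _ => measure_ne_top _ _]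
  simp [measureReal_def]

/-- With a single class the softmax loss vanishes. -/
theorem balancedError_eq_zero_of_one_class {X : Type*} [MeasurableSpace X]
    (P : Fin 1 → Measure X) (h : X → Fin 1 → ℝ) {t : ℝ} (ht : 0 ≤ t) :
    balancedError P h t = 0 := by
  have h0 : ∀ z : X × Fin 1, softmaxNLL (h z.1) z.2 = 0 := fun z => by
    have : Finset.univ.erase z.2 = ∅ := by
      rw [Finset.eq_empty_iff_forall_notMem]
      intro i hi
      exact (Finset.mem_erase.mp hi).1 (Subsingleton.elim _ _)
    rw [softmaxNLL, this, Finset.sum_empty, add_zero, Real.log_one]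
  simp [balancedError, h0, ht.not_gt]

theorem le_of_le_classMargin {k : ℕ} {X : Type*} {n : Fin k → ℕ} {h : X → Fin k → ℝ} {t a : ℝ}
    {S : (j : Fin k) → Fin (n j) → X} {j : Fin k} (ha : a ≤ classMargin h t S j) (l : Fin (n j)) :
    a ≤ t - softmaxNLL (h (S j l)) j := by
  have := le_iSup_of_finite (fun i => softmaxNLL (h (S j i)) j) l
  unfold classMargin at ha
  linarith

theorem rademacherComplexity_le_of_complexityMeasure_le {k : ℕ} {X : Type*} [MeasurableSpace X]
    {P : Fin k → Measure X} {n : Fin k → ℕ} {H : Set (X → Fin k → ℝ)} {t C : ℝ} (hC : 0 ≤ C)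
    (h : complexityMeasure P n H t ≤ ENNReal.ofReal C) {j : Fin k} (hn : 0 < n j) :
    rademacherComplexity (P j) (n j) (shiftedLossClass H t j) ≤ ENNReal.ofReal (√(C / n j)) := by
  have hn' : (0 : ℝ) < n j := by exact_mod_cast hn
  have h1 : (n j : ℝ≥0∞) * rademacherComplexity (P j) (n j) (shiftedLossClass H t j) ^ 2
      ≤ ENNReal.ofReal C :=
    (le_iSup (fun j => (n j : ℝ≥0∞) *
      rademacherComplexity (P j) (n j) (shiftedLossClass H t j) ^ 2) j).trans h
  rw [← ENNReal.pow_le_pow_left_iff two_ne_zero, ← ENNReal.ofReal_pow (Real.sqrt_nonneg _),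
    Real.sq_sqrt (by positivity), ENNReal.ofReal_div_of_pos hn', ENNReal.ofReal_natCast,
    ENNReal.le_div_iff_mul_le (by simp [hn.ne']) (by simp), mul_comm]
  exact h1

theorem marginBound_nonneg {k : ℕ} (n : Fin k → ℕ) (C : ℝ) {γ : Fin k → ℝ} (hγ : ∀ j, 0 < γ j) :
    0 ≤ marginBound n C γ := by
  unfold marginBound
  have : ∀ j, 0 ≤ 1 / γ j * √(C / n j) + Real.log ((∑ i, n i : ℕ) : ℝ) / √(n j) := fun j =>
    add_nonneg (mul_nonneg (one_div_nonneg.mpr (hγ j).le) (Real.sqrt_nonneg _))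
      (div_nonneg (Real.log_natCast_nonneg _) (Real.sqrt_nonneg _))
  exact mul_nonneg (by positivity) (Finset.sum_nonneg fun j _ => this j)

theorem continuous_marginBound {k : ℕ} (n : Fin k → ℕ) (γ : Fin k → ℝ) :
    Continuous fun C => marginBound n C γ := by
  unfold marginBound
  fun_prop

theorem marginBound_mono {k : ℕ} (n : Fin k → ℕ) {C C' : ℝ} (hC : C ≤ C') {γ : Fin k → ℝ}
    (hγ : ∀ j, 0 < γ j) : marginBound n C γ ≤ marginBound n C' γ := by
  unfold marginBound
  have := fun j => one_div_nonneg.mpr (hγ j).le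
  gcongr with j
  exact this j

/-! ### Uniformity over the margins -/

/-- Passing from a grid of margin levels `i * r`, `1 ≤ i ≤ m`, to an arbitrary margin `γ`: below the
grid the bound `e ≤ 1` suffices, and above it the top level already gives `2 / m`. -/
theorem error_le_of_margin_grid {m : ℕ} (hm : 0 < m) {e γ r b : ℝ} (hγ : 0 < γ) (hr : 0 < r)
    (hb : 0 ≤ b) (he : e ≤ 1)
    (h : ∀ i : ℕ, 1 ≤ i → i ≤ m → i * r ≤ γ → e ≤ 2 / i + b) :
    e ≤ 4 * (1 / γ * r) + (2 / √m + b) := by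
  have hm1 : (1 : ℝ) ≤ m := by exact_mod_cast hm
  have hsq : (0 : ℝ) < √m := Real.sqrt_pos.mpr (by linarith)
  have hpos : 0 < 1 / γ * r := by positivity
  rcases lt_or_ge γ r with hlt | hge
  · have : 1 ≤ 1 / γ * r := by
      rw [one_div_mul_eq_div]; exact ((one_lt_div hγ).mpr hlt).le
    have : 0 < 2 / √(m : ℝ) := by positivity
    linarith
  · have hq1 : 1 ≤ γ / r := (one_le_div hr).mpr hge
    have hqf : 1 ≤ ⌊γ / r⌋₊ := Nat.le_floor (by exact_mod_cast hq1)
    have hfle : (⌊γ / r⌋₊ : ℝ) ≤ γ / r := Nat.floor_le (by positivity)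
    rcases le_total ⌊γ / r⌋₊ m with hle | hle
    · have h1 := h _ hqf hle ((le_div_iff₀ hr).mp hfle)
      have hqf' : (1 : ℝ) ≤ ⌊γ / r⌋₊ := by exact_mod_cast hqf
      have h2 : γ / r / 2 ≤ ⌊γ / r⌋₊ := by linarith [Nat.lt_floor_add_one (γ / r)]
      have h3 : 2 / (⌊γ / r⌋₊ : ℝ) ≤ 4 * (1 / γ * r) := by
        calc 2 / (⌊γ / r⌋₊ : ℝ) ≤ 2 / (γ / r / 2) := by gcongr
          _ = 4 * (1 / γ * r) := by field_simp; norm_num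
      have : 0 < 2 / √(m : ℝ) := by positivity
      linarith
    · have hmf : (m : ℝ) ≤ ⌊γ / r⌋₊ := by exact_mod_cast hle
      have h1 := h m hm le_rfl ((le_div_iff₀ hr).mp (hmf.trans hfle))
      have h2 : 2 / (m : ℝ) ≤ 2 / √m := by
        gcongr
        exact Real.sqrt_le_self_iff.mpr (Or.inr hm1)
      linarith

/-- The deviation `√(1 + 2 |log δ|) * log N / √m` has probability at most `δ / N`: there is room
because `log N`, and not only its square root, multiplies `1 / √m`. -/
theorem exp_neg_deviation_le {δ : ℝ} (hδ : 0 < δ) {m N : ℕ} (hm : 0 < m) (hN : 2 ≤ N) :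
    Real.exp (-2 * m * (√(1 + 2 * |Real.log δ|) * (Real.log N / √m)) ^ 2) ≤ δ / N := by
  have hm' : (0 : ℝ) < m := by exact_mod_cast hm
  have hN' : (2 : ℝ) ≤ N := by exact_mod_cast hN
  have hlog : 1 / 2 ≤ Real.log N := by
    linarith [Real.log_le_log two_pos hN', Real.log_two_gt_d9]
  have habs := neg_abs_le (Real.log δ)
  have habs0 := abs_nonneg (Real.log δ)
  rw [← Real.exp_log (show 0 < δ / N by positivity), Real.exp_le_exp,
    Real.log_div hδ.ne' (by positivity), mul_pow, div_pow, Real.sq_sqrt (by positivity),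
    Real.sq_sqrt hm'.le]
  have h1 : -2 * (m : ℝ) * ((1 + 2 * |Real.log δ|) * (Real.log N ^ 2 / m))
      = -(2 * (1 + 2 * |Real.log δ|) * Real.log N ^ 2) := by field_simp
  rw [h1]
  have h2 : Real.log N ≤ 2 * Real.log N ^ 2 := by nlinarith
  have h3 : |Real.log δ| ≤ 4 * |Real.log δ| * Real.log N ^ 2 := by nlinarith
  nlinarith

/-- The margin bound with any constant `C > 0` that bounds the complexity. The union bound runs over
the `n j` margin levels `i * √(C / n j)` of each class `j`, that is, over `∑ j, n j` events. -/
theorem trainingLaw_error_gt_le {δ : ℝ} (hδ : 0 < δ) {k : ℕ} (hk : 2 ≤ k) {X : Type*}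
    [MeasurableSpace X] (P : Fin k → Measure X) [∀ j, IsProbabilityMeasure (P j)]
    {n : Fin k → ℕ} (hn : ∀ j, 0 < n j) {H H₀ : Set (X → Fin k → ℝ)}
    (hH : ∀ h ∈ H, Measurable h) (hsub : H₀ ⊆ H) (hc : H₀.Countable) (hcl : H ⊆ seqClosure H₀)
    {t C : ℝ} (hC : 0 < C) (hHC : complexityMeasure P n H t ≤ ENNReal.ofReal C) :
    trainingLaw P n {S | ∃ h ∈ H, (∀ j, 0 < classMargin h t S j) ∧
      (4 + √(1 + 2 * |Real.log δ|)) * marginBound n C (classMargin h t S) < balancedError P h t}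
        ≤ ENNReal.ofReal δ := by
  set a := √(1 + 2 * |Real.log δ|) with ha
  set N := ∑ j, n j with hNdef
  have hN : 2 ≤ N := by
    calc 2 ≤ ∑ _j : Fin k, 1 := by simpa using hk
      _ ≤ N := Finset.sum_le_sum fun j _ => hn j
  have hN' : (2 : ℝ) ≤ N := by exact_mod_cast hN
  have hlog : 1 / 2 ≤ Real.log N := by
    linarith [Real.log_le_log two_pos hN', Real.log_two_gt_d9]
  have hn' : ∀ j, (0 : ℝ) < n j := fun j => by exact_mod_cast hn j
  set r : Fin k → ℝ := fun j => √(C / n j) with hr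
  have hrpos : ∀ j, 0 < r j := fun j => Real.sqrt_pos.mpr (div_pos hC (hn' j))
  set b : Fin k → ℝ := fun j => a * (Real.log N / √(n j)) with hb
  have hb0 : ∀ j, 0 ≤ b j := fun j => by
    have : 0 ≤ Real.log N := by linarith
    simp only [hb]; positivity
  set A : (j : Fin k) → Fin (n j) → Set (Fin (n j) → X) := fun j i =>
    {x | ∃ f ∈ shiftedLossClass H t j, (∀ l, (i + 1 : ℕ) * r j ≤ f (x l)) ∧
      2 * r j / ((i + 1 : ℕ) * r j) + b j < (P j).real {y | f y < 0}} with hA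
  have hAle : ∀ j i, (Measure.pi fun _ => P j) (A j i) ≤ ENNReal.ofReal (δ / N) := fun j i => by
    refine (measure_exists_margin_le (P j) (hn j) (F₀ := shiftedLossClass H₀ t j) ?_
      (Set.image_mono hsub) (hc.image _) (shiftedLossClass_subset_seqClosure hcl t j)
      (hrpos j).le (mul_pos (Nat.cast_pos.mpr (Nat.succ_pos _)) (hrpos j)) (hb0 j)
      (rademacherComplexity_le_of_complexityMeasure_le hC.le hHC (hn j))).trans
      (ENNReal.ofReal_le_ofReal (exp_neg_deviation_le hδ (hn j) hN))
    rintro _ ⟨h, hh, rfl⟩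
    exact measurable_shiftedLoss (hH h hh) t j
  refine (measure_mono (t := ⋃ j, ⋃ i, Function.eval j ⁻¹' A j i) ?_).trans ?_
  · rintro S ⟨h, hh, hpos, hlt⟩
    by_contra hnot
    simp only [Set.mem_iUnion, not_exists] at hnot
    refine hlt.not_ge ?_
    rw [balancedError_eq_average P (hH h hh), marginBound, mul_left_comm]
    refine mul_le_mul_of_nonneg_left ?_ (by positivity)
    rw [Finset.mul_sum]
    refine Finset.sum_le_sum fun j _ => ?_
    have hgrid := error_le_of_margin_grid (hn j) (hpos j) (hrpos j) (hb0 j)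
      (measureReal_le_one (μ := P j) (s := {x | t - softmaxNLL (h x) j < 0})) fun i hi him hir => by
        by_contra! hcon
        refine hnot j ⟨i - 1, by omega⟩ ⟨_, ⟨h, hh, rfl⟩, fun l => ?_, ?_⟩
        · simp only [Nat.sub_add_cancel hi]
          exact le_of_le_classMargin hir l
        · simp only [Nat.sub_add_cancel hi]
          rwa [mul_div_mul_right _ _ (hrpos j).ne']
    refine hgrid.trans ?_
    have h1 : 2 / √(n j : ℝ) ≤ 4 * (Real.log N / √(n j)) := by
      rw [← mul_div_assoc]
      gcongr
      linarith
    have h2 : 0 ≤ a * (1 / classMargin h t S j * r j) := by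
      have := hpos j
      have := hrpos j
      positivity
    simp only [hb]
    linarith
  · calc trainingLaw P n (⋃ j, ⋃ i, Function.eval j ⁻¹' A j i)
        ≤ ∑ j, ∑ i, trainingLaw P n (Function.eval j ⁻¹' A j i) :=
          (measure_iUnion_fintype_le _ _).trans
            (Finset.sum_le_sum fun j _ => measure_iUnion_fintype_le _ _)
      _ ≤ ∑ j, ∑ _i : Fin (n j), ENNReal.ofReal (δ / N) := by
          refine Finset.sum_le_sum fun j _ => Finset.sum_le_sum fun i _ => ?_
          have hmp := measurePreserving_eval (fun j => Measure.pi fun _ : Fin (n j) => P j) j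
          refine (Measure.le_map_apply hmp.measurable.aemeasurable _).trans ?_
          rw [trainingLaw, hmp.map_eq]
          exact hAle j i
      _ = ENNReal.ofReal δ := by
          simp only [Finset.sum_const, Finset.card_univ, Fintype.card_fin, nsmul_eq_mul]
          rw [← Finset.sum_mul, ← Nat.cast_sum, ← ENNReal.ofReal_natCast,
            ← ENNReal.ofReal_mul (by positivity), mul_div_cancel₀]
          positivity

/-! ### Optimal margins -/

theorem sum_rpow_pos {k : ℕ} (hk : 0 < k) {n : Fin k → ℕ} (hn : ∀ j, 0 < n j) :
    0 < ∑ i, (n i : ℝ) ^ (-(1 / 4) : ℝ) := by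
  have : Nonempty (Fin k) := ⟨⟨0, hk⟩⟩
  exact Finset.sum_pos (fun i _ => Real.rpow_pos_of_pos (by exact_mod_cast hn i) _)
    Finset.univ_nonempty

theorem optimalMargin_mem_admissibleMargins {k : ℕ} (hk : 0 < k) {n : Fin k → ℕ}
    (hn : ∀ j, 0 < n j) {β : ℝ} (hβ : 0 < β) : optimalMargin n β ∈ admissibleMargins k β := by
  have hW := sum_rpow_pos hk hn
  refine ⟨fun j => div_pos (mul_pos hβ (Real.rpow_pos_of_pos (by exact_mod_cast hn j) _)) hW, ?_⟩
  simp only [optimalMargin]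
  rw [← Finset.sum_div, ← Finset.mul_sum, mul_div_cancel_right₀ _ hW.ne']

/-- The excess of the bound over its value at the optimal margins. Since
`√(C / n j) = √C * (n j ^ (-1/4))²` is proportional to the square of the optimal margin, the
first-order terms sum to a multiple of `∑ j, (γ j - γ* j) = 0`. -/
theorem marginBound_sub_optimal {k : ℕ} (hk : 0 < k) {n : Fin k → ℕ} (hn : ∀ j, 0 < n j) (C : ℝ)
    {β : ℝ} (hβ : 0 < β) {γ : Fin k → ℝ} (hγ : γ ∈ admissibleMargins k β) :
    marginBound n C γ - marginBound n C (optimalMargin n β) =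
      1 / (k : ℝ) * (√C * ((∑ i, (n i : ℝ) ^ (-(1 / 4) : ℝ)) / β) ^ 2 *
        ∑ j, (γ j - optimalMargin n β j) ^ 2 / γ j) := by
  obtain ⟨hopos, hosum⟩ := optimalMargin_mem_admissibleMargins hk hn hβ
  have hW := sum_rpow_pos hk hn
  set W := ∑ i, (n i : ℝ) ^ (-(1 / 4) : ℝ) with hWdef
  have hsq : ∀ j, √(C / n j) = √C * (W / β) ^ 2 * optimalMargin n β j ^ 2 := fun j => by
    have hnj : (0 : ℝ) < n j := by exact_mod_cast hn j
    have h1 : ((n j : ℝ) ^ (-(1 / 4) : ℝ)) ^ 2 = (√(n j))⁻¹ := by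
      rw [← Real.rpow_natCast, ← Real.rpow_mul hnj.le, Real.sqrt_eq_rpow, ← Real.rpow_neg hnj.le]
      norm_num
    rw [Real.sqrt_div' _ hnj.le, optimalMargin, ← hWdef, div_pow, div_pow, mul_pow, h1]
    field_simp
  have hterm : ∀ j, 1 / γ j * √(C / n j) - 1 / optimalMargin n β j * √(C / n j) =
      √C * (W / β) ^ 2 * ((γ j - optimalMargin n β j) ^ 2 / γ j)
        - √C * (W / β) ^ 2 * (γ j - optimalMargin n β j) := fun j => by
    have h1 := (hγ.1 j).ne'
    have h2 := (hopos j).ne'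
    rw [hsq]
    field_simp
    ring
  have hzero : ∑ j, (γ j - optimalMargin n β j) = 0 := by
    rw [Finset.sum_sub_distrib, hγ.2, hosum, sub_self]
  rw [marginBound, marginBound, ← mul_sub, ← Finset.sum_sub_distrib]
  simp only [add_sub_add_right_eq_sub, hterm]
  rw [Finset.sum_sub_distrib, ← Finset.mul_sum, ← Finset.mul_sum, hzero, mul_zero, sub_zero]

/-! ### The error bound and the optimal margins -/

theorem theorem2 :
    (∀ δ : ℝ, 0 < δ → ∃ K : ℝ, 0 < K ∧
      ∀ (k : ℕ), 0 < k →
      ∀ (X : Type*) [MeasurableSpace X] (P : Fin k → Measure X) [∀ j, IsProbabilityMeasure (P j)]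
        (n : Fin k → ℕ), (∀ j, 0 < n j) →
      ∀ (H : Set (X → Fin k → ℝ)), (∀ h ∈ H, Measurable h) →
        (∃ H₀ ⊆ H, H₀.Countable ∧ H ⊆ seqClosure H₀) →
      ∀ t : ℝ, 0 ≤ t → complexityMeasure P n H t ≠ ⊤ →
        trainingLaw P n {S | ¬ ∀ h ∈ H, (∀ j, 0 < classMargin h t S j) →
          balancedError P h t ≤
            K * marginBound n (complexityMeasure P n H t).toReal (classMargin h t S)}
          ≤ ENNReal.ofReal δ) ∧
    (∀ (k : ℕ), 0 < k → ∀ (n : Fin k → ℕ), (∀ j, 0 < n j) → ∀ C : ℝ, 0 ≤ C → ∀ β : ℝ, 0 < β →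
      optimalMargin n β ∈ admissibleMargins k β ∧
      IsMinOn (marginBound n C) (admissibleMargins k β) (optimalMargin n β) ∧
      (0 < C → ∀ γ ∈ admissibleMargins k β,
        marginBound n C γ = marginBound n C (optimalMargin n β) → γ = optimalMargin n β)) := by
  refine ⟨fun δ hδ => ⟨4 + √(1 + 2 * |Real.log δ|), by positivity, ?_⟩, ?_⟩
  · rintro k hk X _ P _ n hn H hH ⟨H₀, hsub, hc, hcl⟩ t ht hCtop
    set K := 4 + √(1 + 2 * |Real.log δ|) with hK
    have hKpos : 0 < K := by positivity
    obtain rfl | hk2 : k = 1 ∨ 2 ≤ k := by omega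
    · have hempty : {S : (j : Fin 1) → Fin (n j) → X | ¬ ∀ h ∈ H,
          (∀ j, 0 < classMargin h t S j) → balancedError P h t ≤
            K * marginBound n (complexityMeasure P n H t).toReal (classMargin h t S)} = ∅ := by
        refine Set.eq_empty_of_forall_notMem fun S hS => hS fun h _ hpos => ?_
        rw [balancedError_eq_zero_of_one_class P h ht]
        exact mul_nonneg hKpos.le (marginBound_nonneg n _ hpos)
      rw [hempty, measure_empty]
      exact zero_le
    · set C := (complexityMeasure P n H t).toReal with hCdef
      have hC0 : 0 ≤ C := ENNReal.toReal_nonneg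
      -- The grid of levels degenerates for `C = 0`, so the bound is taken to the limit `C' ↓ C`.
      set ε : ℕ → ℝ := fun p => 1 / ((p : ℝ) + 1) with hε
      have hεpos : ∀ p, 0 < ε p := fun p => Nat.one_div_pos_of_nat
      set A : ℕ → Set ((j : Fin k) → Fin (n j) → X) := fun p =>
        {S | ∃ h ∈ H, (∀ j, 0 < classMargin h t S j) ∧
          K * marginBound n (C + ε p) (classMargin h t S) < balancedError P h t} with hA
      have hmono : Monotone A := by
        rintro p q hpq S ⟨h, hh, hpos, hlt⟩
        refine ⟨h, hh, hpos, lt_of_le_of_lt (mul_le_mul_of_nonneg_left ?_ hKpos.le) hlt⟩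
        exact marginBound_mono n (by linarith [Nat.one_div_le_one_div (α := ℝ) hpq]) hpos
      refine (measure_mono (t := ⋃ p, A p) ?_).trans ?_
      · intro S hS
        simp only [Set.mem_ofPred_eq, not_forall, not_le] at hS
        obtain ⟨h, hh, hpos, hlt⟩ := hS
        have hlim : Filter.Tendsto
            (fun p => K * marginBound n (C + ε p) (classMargin h t S)) Filter.atTop
            (nhds (K * marginBound n C (classMargin h t S))) := by
          refine Filter.Tendsto.const_mul K (((continuous_marginBound n _).tendsto C).comp ?_)
          simpa [hε] using tendsto_one_div_add_atTop_nhds_zero_nat.const_add C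
        obtain ⟨p, hp⟩ := (hlim.eventually (gt_mem_nhds hlt)).exists
        exact Set.mem_iUnion.mpr ⟨p, h, hh, hpos, hp⟩
      · rw [hmono.measure_iUnion]
        refine iSup_le fun p => trainingLaw_error_gt_le hδ hk2 P hn hH hsub hc hcl
          (by linarith [hεpos p]) ?_
        rw [← ENNReal.ofReal_toReal hCtop]
        exact ENNReal.ofReal_le_ofReal (by linarith [hεpos p])
  · intro k hk n hn C hC β hβ
    have hopt := optimalMargin_mem_admissibleMargins hk hn hβ
    have hW := sum_rpow_pos hk hn
    have hk' : (0 : ℝ) < k := by exact_mod_cast hk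
    refine ⟨hopt, fun γ hγ => ?_, fun hCpos γ hγ heq => ?_⟩
    · have h1 := marginBound_sub_optimal hk hn C hβ hγ
      have h2 : 0 ≤ ∑ j, (γ j - optimalMargin n β j) ^ 2 / γ j :=
        Finset.sum_nonneg fun j _ => div_nonneg (sq_nonneg _) (hγ.1 j).le
      change marginBound n C (optimalMargin n β) ≤ marginBound n C γ
      rw [← sub_nonneg, h1]
      positivity
    · have h1 := marginBound_sub_optimal hk hn C hβ hγ
      have hsC := Real.sqrt_pos.mpr hCpos
      rw [heq, sub_self, eq_comm, mul_eq_zero, or_iff_right (by positivity), mul_eq_zero,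
        or_iff_right (by positivity), Finset.sum_eq_zero_iff_of_nonneg fun j _ =>
          div_nonneg (sq_nonneg _) (hγ.1 j).le] at h1
      funext j
      have h2 := h1 j (Finset.mem_univ j)
      rw [div_eq_zero_iff, or_iff_left (hγ.1 j).ne', sq_eq_zero_iff] at h2
      exact sub_eq_zero.mp h2
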